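/- Let $\mathbb{X}$ be a separable reflexive real Banach space with strictly convex dual $\mathbb{X}^*$, let $\mathbb{U}$ be a separable real Hilbert space (identified with its dual), let $\mathcal{T}(t)$, $t\ge 0$, be a $C_0$-semigroup on $\mathbb{X}$ with generator $\mathrm{A}$ and $\|\mathcal{T}(t)\|\le M$ for all $t\ge0$, and let $\mathrm{B}:\mathbb{U}\to\mathbb{X}$ be a bounded linear operator. Fix $\frac12<\alpha<1$, $T>0$, $\lambda>0$ and $\zeta,x_T\in\mathbb{X}$. Put, for $\xi>0$, $$\phi_\alpha(\xi)=\frac1\pi\sum_{n=1}^\infty(-1)^{n-1}\xi^{-n\alpha-1}\frac{\Gamma(n\alpha+1)}{n!}\sin(n\pi\alpha),\qquad \varphi_\alpha(\xi)=\frac1\alpha\,\xi^{-1-\frac1\alpha}\phi_\alpha(\xi^{-\frac1\alpha}),$$ and, for $t\ge0$, $x\in\mathbb{X}$, $$\mathcal{T}_\alpha(t)x=\int_0^\infty\varphi_\alpha(\xi)\mathcal{T}(t^\alpha\xi)x\,d\xi,\qquad \widehat{\mathcal{T}}_\alpha(t)x=\alpha\int_0^\infty\xi\varphi_\alpha(\xi)\mathcal{T}(t^\alpha\xi)x\,d\xi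 .$$ Let $\mathcal{J}:\mathbb{X}\to\mathbb{X}^*$ be the (single-valued) duality map, $\langle x,\mathcal{J}[x]\rangle=\|x\|^2=\|\mathcal{J}[x]\|^2$, and let $$\Phi_0^T=\int_0^T(T-t)^{2(\alpha-1)}\widehat{\mathcal{T}}_\alpha(T-t)\mathrm{B}\mathrm{B}^*\widehat{\mathcal{T}}_\alpha(T-t)^*\,dt:\mathbb{X}^*\to\mathbb{X}.$$ Consider the linear regulator problem of minimizing $$\mathcal{G}(x,u)=\|x(T)-x_T\|_{\mathbb{X}}^2+\lambda\int_0^T\|u(t)\|_{\mathbb{U}}^2\,dt$$ over all pairs $(x,u)$ with $u\in L^2([0,T];\mathbb{U})$ and $x$ the mild solution of ${}^C\!D^\alpha_{0,t}x=\mathrm{A}x+\mathrm{B}u$, $x(0)=\zeta$, that is, $$x(t)=\mathcal{T}_\alpha(t)\zeta+\int_0^t(t-s)^{\alpha-1}\widehat{\mathcal{T}}_\alpha(t-s)\mathrm{B}u(s)\,ds,\qquad t\in[0,T].$$ Let $(x,u)$ be an optimal pair of this problem. Then the map $\lambda\mathrm{I}+\Phi_0^T\mathcal{J}:\mathbb{X}\to\mathbb{X}$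 is bijective, so that the resolvent $\mathcal{R}(\lambda,\Phi_0^T)=(\lambda\mathrm{I}+\Phi_0^T\mathcal{J})^{-1}$ is defined, and the optimal control is given by $$u(t)=(T-t)^{\alpha-1}\,\mathrm{B}^*\,\widehat{\mathcal{T}}_\alpha(T-t)^*\,\mathcal{J}\big[\mathcal{R}(\lambda,\Phi_0^T)\,(x_T-\mathcal{T}_\alpha(T)\zeta)\big],\qquad t\in[0,T),$$ where the right-hand side is continuous on $[0,T)$ and the equality holds for almost every $t\in[0,T)$ (hence for every $t\in[0,T)$ if $u$ denotes the continuous representative of the optimal control). -/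

import Mathlib

noncomputable section

open MeasureTheory Set Filter Topology
open scoped NNReal

namespace FracRegulator

/-- One-sided stable probability density of order `q`,
`φ_q(ξ) = π⁻¹ ∑_{n ≥ 1} (-1)^(n-1) ξ^(-nq-1) Γ(nq+1)/n! sin(nπq)`, for `ξ > 0`, `0 < q < 1`
(the summation index is shifted by one). -/
def stableDensity (q ξ : ℝ) : ℝ :=
  1 / Real.pi * ∑' n : ℕ, (-1) ^ n * ξ ^ (-((n + 1 : ℕ) : ℝ) * q - 1) *
    (Real.Gamma (((n + 1 : ℕ) : ℝ) * q + 1) / ((n + 1).factorial : ℝ)) *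
      Real.sin (((n + 1 : ℕ) : ℝ) * Real.pi * q)

/-- The probability density `ϕ_q(ξ) = q⁻¹ ξ^(-1-1/q) φ_q(ξ^(-1/q))` on `(0, ∞)`, where `φ_q` is the
stable density above. -/
def subordDensity (q ξ : ℝ) : ℝ :=
  1 / q * ξ ^ (-1 - 1 / q) * stableDensity q (ξ ^ (-(1 / q)))

/-! Integrability of `ξ ↦ ξ * subordDensity q ξ` on `(0, ∞)`, needed to see that the operator
`hatOp` below is bounded. -/

theorem gammaRay_deriv {s : ℝ} (hs : 0 < s) {w : ℂ} (hw : 0 < w.re) :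
    DifferentiableAt ℂ
      (fun w : ℂ => ∫ t in Ioi (0 : ℝ), ((t ^ (s - 1) : ℝ) : ℂ) * Complex.exp (-(w * t))) w := by
  have hc : 0 < w.re / 2 := by positivity
  have hmeas : ∀ z : ℂ, AEStronglyMeasurable
      (fun t : ℝ => ((t ^ (s - 1) : ℝ) : ℂ) * Complex.exp (-(z * t))) (volume.restrict (Ioi 0)) := by
    intro z
    apply Measurable.aestronglyMeasurable
    fun_prop
  have hint : ∀ p : ℝ, -1 < p → ∀ c : ℝ, 0 < c →
      IntegrableOn (fun t : ℝ => t ^ p * Real.exp (-c * t)) (Ioi 0) := by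
    intro p hp c hc
    simpa using integrableOn_rpow_mul_exp_neg_mul_rpow (s := p) (p := 1) (b := c) hp one_pos hc
  refine (hasDerivAt_integral_of_dominated_loc_of_deriv_le (𝕜 := ℂ)
    (F := fun (w : ℂ) (t : ℝ) => ((t ^ (s - 1) : ℝ) : ℂ) * Complex.exp (-(w * t)))
    (F' := fun (w : ℂ) (t : ℝ) => ((t ^ (s - 1) : ℝ) : ℂ) * (Complex.exp (-(w * t)) * (-t)))
    (bound := fun t => t ^ s * Real.exp (-(w.re / 2) * t))
    (s := {z : ℂ | w.re / 2 < z.re}) (x₀ := w) ?_ ?_ ?_ ?_ ?_ ?_ ?_).2.differentiableAt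
  · exact (isOpen_lt continuous_const Complex.continuous_re).mem_nhds (by simp; linarith)
  · exact Eventually.of_forall hmeas
  · refine (hint (s - 1) (by linarith) w.re hw).mono' (hmeas w) ?_
    filter_upwards [ae_restrict_mem measurableSet_Ioi] with t ht
    have ht : 0 < t := ht
    rw [norm_mul, Complex.norm_exp, Complex.norm_real, Real.norm_of_nonneg (by positivity)]
    simp
  · apply Measurable.aestronglyMeasurable
    fun_prop
  · filter_upwards [ae_restrict_mem measurableSet_Ioi] with t ht z hz
    have ht : 0 < t := ht
    have hz : w.re / 2 < z.re := hz
    rw [norm_mul, norm_mul, Complex.norm_exp, Complex.norm_real, norm_neg, Complex.norm_real,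
      Real.norm_of_nonneg (by positivity), Real.norm_of_nonneg ht.le]
    have : t ^ s = t ^ (s - 1) * t := by rw [← Real.rpow_add_one ht.ne']; simp
    rw [this, mul_comm (Real.exp _) t, ← mul_assoc]
    gcongr
    simp
    nlinarith
  · exact hint s (by linarith) _ hc
  · refine Eventually.of_forall fun t z _ => ?_
    have h1 : HasDerivAt (fun z : ℂ => -(z * (t : ℂ))) (-(t : ℂ)) z := by
      simpa using! ((hasDerivAt_id z).mul_const (t : ℂ)).neg
    exact (h1.cexp).const_mul _

theorem gammaRay {s : ℝ} (hs : 0 < s) {w : ℂ} (hw : 0 < w.re) :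
    ∫ t in Ioi (0 : ℝ), ((t ^ (s - 1) : ℝ) : ℂ) * Complex.exp (-(w * t))
      = w ^ (-(s : ℂ)) * (Real.Gamma s : ℂ) := by
  have hopen : IsOpen {z : ℂ | 0 < z.re} := isOpen_lt continuous_const Complex.continuous_re
  have hf : AnalyticOnNhd ℂ
      (fun w : ℂ => ∫ t in Ioi (0 : ℝ), ((t ^ (s - 1) : ℝ) : ℂ) * Complex.exp (-(w * t)))
      {z : ℂ | 0 < z.re} :=
    DifferentiableOn.analyticOnNhd
      (fun z hz => (gammaRay_deriv hs hz).differentiableWithinAt) hopen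
  have hg : AnalyticOnNhd ℂ (fun w : ℂ => w ^ (-(s : ℂ)) * (Real.Gamma s : ℂ))
      {z : ℂ | 0 < z.re} := by
    refine DifferentiableOn.analyticOnNhd (fun z hz => ?_) hopen
    refine DifferentiableAt.differentiableWithinAt ?_
    refine DifferentiableAt.mul_const ?_ _
    exact differentiableAt_id.cpow_const (Or.inl hz)
  refine hf.eqOn_of_preconnected_of_frequently_eq hg
    ((convex_halfSpace_re_gt 0).isPreconnected) (z₀ := 1) (by simp) ?_ hw
  have hreal : ∀ r : ℝ, 0 < r →
      ∫ t in Ioi (0 : ℝ), ((t ^ (s - 1) : ℝ) : ℂ) * Complex.exp (-((r : ℂ) * t))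
      = (r : ℂ) ^ (-(s : ℂ)) * (Real.Gamma s : ℂ) := by
    intro r hr
    have h := Real.integral_rpow_mul_exp_neg_mul_Ioi hs hr
    have h2 : (1 / r) ^ s = r ^ (-s) := by
      rw [Real.rpow_neg hr.le, one_div, Real.inv_rpow hr.le]
    rw [h2] at h
    have h3 := congrArg (fun x : ℝ => (x : ℂ)) h
    simp only [← integral_complex_ofReal] at h3
    rw [Complex.ofReal_mul, Complex.ofReal_cpow hr.le] at h3
    push_cast at h3 ⊢
    exact h3
  have hseq : Tendsto (fun n : ℕ => ((1 + 1 / ((n : ℝ) + 1) : ℝ) : ℂ)) atTop (𝓝[≠] 1) := by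
    refine tendsto_nhdsWithin_iff.2 ⟨?_, Eventually.of_forall fun n => ?_⟩
    · have h1 : Tendsto (fun n : ℕ => (1 + 1 / ((n : ℝ) + 1) : ℝ)) atTop (𝓝 (1 + 0)) :=
        tendsto_const_nhds.add tendsto_one_div_add_atTop_nhds_zero_nat
      have h2 := (Complex.continuous_ofReal.tendsto (1 + 0 : ℝ)).comp h1
      simpa only [add_zero, Complex.ofReal_one] using! h2
    · have h3 : (0 : ℝ) < 1 / ((n : ℝ) + 1) := by positivity
      have : (1 + 1 / ((n : ℝ) + 1) : ℝ) ≠ 1 := by linarith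
      simp only [mem_compl_iff, mem_singleton_iff]
      exact_mod_cast this
  exact hseq.frequently (Frequently.of_forall fun n => hreal _ (by positivity))

theorem integrableOn_exp_rpow_sub {q c : ℝ} (hq0 : 0 < q) (hq : q < 1) (hc : 0 < c) (ξ : ℝ) :
    IntegrableOn (fun t : ℝ => Real.exp (ξ * t ^ q - c * t)) (Ioi 0) := by
  refine integrable_of_isBigO_exp_neg (b := c / 2) (by positivity) ?_ ?_
  · refine Continuous.continuousOn ?_
    have : Continuous fun t : ℝ => t ^ q := Real.continuous_rpow_const hq0.le
    fun_prop
  · have h1 : Tendsto (fun t : ℝ => ξ * t ^ (-(1 - q))) atTop (𝓝 (ξ * 0)) :=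
      (tendsto_rpow_neg_atTop (by linarith)).const_mul ξ
    rw [mul_zero] at h1
    refine Asymptotics.IsBigO.of_bound 1 ?_
    filter_upwards [h1.eventually_lt_const (show 0 < c / 2 by positivity), eventually_gt_atTop 0]
      with t ht ht0
    have h2 : t ^ q = t ^ (-(1 - q)) * t := by
      rw [← Real.rpow_add_one ht0.ne']; congr 1; ring
    rw [Real.norm_of_nonneg (Real.exp_pos _).le, Real.norm_of_nonneg (Real.exp_pos _).le, one_mul]
    apply Real.exp_le_exp.2
    rw [h2]
    nlinarith

/-- Auxiliary kernel, used only for the integrability of `ξ * subordDensity q ξ`. -/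
def rayKernel (q δ β ξ t : ℝ) : ℂ :=
  Complex.exp (-(ξ * (t ^ q : ℝ) * Complex.exp (β * Complex.I)))
    * Complex.exp (-(Complex.exp (-(δ * Complex.I)) * t))

theorem norm_rayKernel (q δ β ξ t : ℝ) :
    ‖rayKernel q δ β ξ t‖
      = Real.exp (-(Real.cos β * t ^ q) * ξ) * Real.exp (-Real.cos δ * t) := by
  unfold rayKernel
  rw [norm_mul, Complex.norm_exp, Complex.norm_exp]
  have h1 : (Complex.exp (β * Complex.I)).re = Real.cos β := Complex.exp_ofReal_mul_I_re β
  have h2 : (Complex.exp (-(δ * Complex.I))).re = Real.cos δ := by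
    rw [← neg_mul, ← Complex.ofReal_neg, Complex.exp_ofReal_mul_I_re, Real.cos_neg]
  rw [← Complex.ofReal_mul, Complex.neg_re, Complex.re_ofReal_mul, h1, Complex.neg_re,
    Complex.re_mul_ofReal, h2]
  congr 1 <;> congr 1 <;> ring

theorem integrable_rayKernel {q δ β : ℝ} (hq : q < 1) (hδ : 0 < Real.cos δ)
    (hβ : 0 < Real.cos β) :
    Integrable (fun p : ℝ × ℝ => rayKernel q δ β p.1 p.2)
      ((volume.restrict (Ioi 0)).prod (volume.restrict (Ioi 0))) := by
  have hm : Measurable (fun p : ℝ × ℝ => rayKernel q δ β p.1 p.2) := by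
    unfold rayKernel
    fun_prop
  rw [integrable_prod_iff' hm.aestronglyMeasurable]
  constructor
  · filter_upwards [ae_restrict_mem measurableSet_Ioi] with t ht
    have ht : 0 < t := ht
    refine Integrable.mono' (g := fun ξ => ‖rayKernel q δ β ξ t‖) ?_
      (hm.comp (by fun_prop : Measurable fun ξ : ℝ => (ξ, t))).aestronglyMeasurable
      (Eventually.of_forall fun ξ => le_rfl)
    simp only [norm_rayKernel]
    refine Integrable.mul_const (integrableOn_exp_mul_Ioi ?_ 0) _
    have : 0 < t ^ q := by positivity
    nlinarith
  · have h1 := integrableOn_rpow_mul_exp_neg_mul_rpow (s := -q) (p := 1) (b := Real.cos δ)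
      (by linarith) one_pos hδ
    refine Integrable.congr (h1.const_mul (Real.cos β)⁻¹) ?_
    filter_upwards [ae_restrict_mem measurableSet_Ioi] with t ht
    have ht : 0 < t := ht
    have h2 : 0 < t ^ q := by positivity
    simp only [norm_rayKernel]
    rw [integral_mul_const, integral_exp_mul_Ioi (by nlinarith), Real.rpow_neg ht.le]
    simp
    field_simp

theorem mul_subordDensity {q δ : ℝ} (hq0 : 0 < q) (hq : q < 1) (hδ : 0 < Real.cos δ)
    (hδ1 : -Real.pi < -δ) (hδ2 : -δ ≤ Real.pi)
    {ξ : ℝ} (hξ : 0 < ξ) :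
    ξ * subordDensity q ξ = -(1 / (Real.pi * q)) *
      (Complex.exp (-(δ * Complex.I)) *
        ∫ t in Ioi (0 : ℝ), rayKernel q δ (q * (Real.pi - δ)) ξ t).im := by
  set β := q * (Real.pi - δ) with hβ
  set w := Complex.exp (-(δ * Complex.I)) with hw
  have hwre : w.re = Real.cos δ := by
    rw [hw, ← neg_mul, ← Complex.ofReal_neg, Complex.exp_ofReal_mul_I_re, Real.cos_neg]
  have hwpow : ∀ s : ℝ, w ^ (-(s : ℂ)) = Complex.exp (s * δ * Complex.I) := by
    intro s
    rw [hw, Complex.cpow_def_of_ne_zero (Complex.exp_ne_zero _),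
      Complex.log_exp (by simpa using hδ1) (by simpa using hδ2)]
    congr 1; ring
  have hsum := hasSum_integral_of_dominated_convergence (μ := volume.restrict (Ioi (0 : ℝ)))
    (F := fun (n : ℕ) (t : ℝ) => (-(ξ * (t ^ q : ℝ) * Complex.exp (β * Complex.I))) ^ n
        / (n.factorial : ℂ) * Complex.exp (-(w * t)))
    (f := fun t => rayKernel q δ β ξ t)
    (fun n t => (ξ * t ^ q) ^ n / n.factorial * Real.exp (-Real.cos δ * t))
    (fun n => by
      apply Measurable.aestronglyMeasurable
      fun_prop)
    (fun n => by
      filter_upwards [ae_restrict_mem measurableSet_Ioi] with t ht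
      have ht : 0 < t := ht
      rw [norm_mul, norm_div, norm_pow, norm_neg, norm_mul, norm_mul, Complex.norm_exp_ofReal_mul_I,
        Complex.norm_real, Complex.norm_real, Real.norm_of_nonneg hξ.le,
        Real.norm_of_nonneg (by positivity), Complex.norm_natCast, Complex.norm_exp, mul_one,
        Complex.neg_re, Complex.re_mul_ofReal, hwre, neg_mul])
    (by
      refine Eventually.of_forall fun t => Summable.mul_right _ ?_
      exact Real.summable_pow_div_factorial _)
    (by
      refine (integrableOn_exp_rpow_sub hq0 hq hδ ξ).congr ?_
      refine Eventually.of_forall fun t => ?_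
      simp only
      rw [tsum_mul_right, (NormedSpace.expSeries_div_hasSum_exp (ξ * t ^ q)).tsum_eq, ← Real.exp_eq_exp_ℝ,
        ← Real.exp_add]
      congr 1; ring)
    (by
      refine Eventually.of_forall fun t => ?_
      refine HasSum.mul_right _ ?_
      rw [Complex.exp_eq_exp_ℂ]
      exact NormedSpace.expSeries_div_hasSum_exp _)
  have hterm : ∀ n : ℕ, (w * ∫ t in Ioi (0 : ℝ),
      (-(ξ * (t ^ q : ℝ) * Complex.exp (β * Complex.I))) ^ n
        / (n.factorial : ℂ) * Complex.exp (-(w * t))).im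
      = (-ξ) ^ n / n.factorial * Real.Gamma (n * q + 1) * Real.sin (n * Real.pi * q) := by
    intro n
    have hs : 0 < (n : ℝ) * q + 1 := by positivity
    have h1 : ∀ t ∈ Ioi (0 : ℝ), (-(ξ * (t ^ q : ℝ) * Complex.exp (β * Complex.I))) ^ n
        / (n.factorial : ℂ) * Complex.exp (-(w * t))
        = ((-ξ : ℂ) ^ n / n.factorial * Complex.exp (n * β * Complex.I)) *
          (((t ^ ((n : ℝ) * q + 1 - 1) : ℝ) : ℂ) * Complex.exp (-(w * t))) := by
      intro t ht
      have ht : 0 < t := ht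
      have e1 : t ^ ((n : ℝ) * q + 1 - 1) = (t ^ q) ^ n := by
        rw [← Real.rpow_natCast, ← Real.rpow_mul ht.le]; congr 1; ring
      have e2 : Complex.exp (n * β * Complex.I) = Complex.exp (β * Complex.I) ^ n := by
        rw [← Complex.exp_nat_mul]; congr 1; ring
      rw [e1, e2, Complex.ofReal_pow, ← neg_mul, ← neg_mul, mul_pow, mul_pow]
      ring
    rw [setIntegral_congr_fun measurableSet_Ioi h1, integral_const_mul,
      gammaRay hs (by rw [hwre]; exact hδ), hwpow]
    have h2 : w * ((-ξ : ℂ) ^ n / n.factorial * Complex.exp (n * β * Complex.I) *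
        (Complex.exp (((n * q + 1 : ℝ) : ℂ) * δ * Complex.I) * (Real.Gamma (n * q + 1) : ℂ)))
        = ((((-ξ) ^ n / n.factorial * Real.Gamma (n * q + 1) : ℝ)) : ℂ) *
          Complex.exp (((n * Real.pi * q : ℝ) : ℂ) * Complex.I) := by
      have e3 : w * Complex.exp (n * β * Complex.I) *
          Complex.exp (((n * q + 1 : ℝ) : ℂ) * δ * Complex.I)
          = Complex.exp (((n * Real.pi * q : ℝ) : ℂ) * Complex.I) := by
        rw [hw, ← Complex.exp_add, ← Complex.exp_add, hβ]
        congr 1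
        push_cast
        ring
      rw [← e3]
      push_cast
      ring
    rw [h2, Complex.im_ofReal_mul, Complex.exp_ofReal_mul_I_im]
  have hsum2 := Complex.hasSum_im (hsum.mul_left w)
  simp only [hterm] at hsum2
  rw [← hasSum_nat_add_iff' 1] at hsum2
  simp only [Finset.range_one, Finset.sum_singleton, Nat.cast_zero, zero_mul, Real.sin_zero,
    mul_zero, sub_zero] at hsum2
  rw [← hsum2.tsum_eq, subordDensity, stableDensity, ← tsum_mul_left, ← tsum_mul_left,
    ← tsum_mul_left, ← tsum_mul_left]
  refine tsum_congr fun n => ?_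
  have e4 : (ξ ^ (-(1 / q))) ^ (-((n + 1 : ℕ) : ℝ) * q - 1) = ξ ^ (n + 1) * ξ ^ (1 / q) := by
    rw [← Real.rpow_mul hξ.le, ← Real.rpow_natCast, ← Real.rpow_add hξ]
    congr 1
    field_simp
    ring
  have e5 : ξ ^ (-1 - 1 / q) = ξ⁻¹ * (ξ ^ (1 / q))⁻¹ := by
    rw [sub_eq_add_neg, Real.rpow_add hξ, Real.rpow_neg hξ.le, Real.rpow_neg hξ.le, Real.rpow_one]
  have e6 : 0 < ξ ^ (1 / q) := by positivity
  rw [e4, e5, neg_pow ξ]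
  field_simp
  ring

theorem integrableOn_mul_subordDensity {q : ℝ} (hq0 : 0 < q) (hq : q < 1) :
    IntegrableOn (fun ξ => ξ * subordDensity q ξ) (Ioi 0) := by
  have hpi := Real.pi_pos
  set δ := Real.pi / 2 - Real.pi * (1 - q) / 4 with hδ
  have hc1 : 0 < Real.cos δ := Real.cos_pos_of_mem_Ioo ⟨by nlinarith, by nlinarith⟩
  have hc2 : 0 < Real.cos (q * (Real.pi - δ)) := by
    have h1 : q * (Real.pi - δ) = Real.pi / 2 - Real.pi / 4 * ((1 - q) * (2 - q)) := by
      rw [hδ]; ring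
    have h2 : 0 < (1 - q) * (2 - q) := by nlinarith
    have h3 : (1 - q) * (2 - q) < 2 := by nlinarith
    refine Real.cos_pos_of_mem_Ioo ⟨by rw [h1]; nlinarith, by rw [h1]; nlinarith⟩
  have h := (integrable_rayKernel hq hc1 hc2).integral_prod_left
  refine Integrable.congr (((h.const_mul (Complex.exp (-(δ * Complex.I)))).im).const_mul
    (-(1 / (Real.pi * q)))) ?_
  filter_upwards [ae_restrict_mem measurableSet_Ioi] with ξ hξ
  rw [mul_subordDensity hq0 hq hc1 (by nlinarith) (by nlinarith) hξ]
  rfl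

/-- A strongly continuous semigroup (`C₀`-semigroup) of bounded linear operators. -/
structure C0Semigroup (X : Type*) [NormedAddCommGroup X] [NormedSpace ℝ X] where
  /-- the operator at time `t ≥ 0` -/
  op : ℝ≥0 → X →L[ℝ] X
  op_zero : op 0 = ContinuousLinearMap.id ℝ X
  op_add : ∀ s t : ℝ≥0, op (s + t) = (op s).comp (op t)
  continuous_orbit : ∀ x : X, Continuous fun t => op t x

/-- The set-valued duality mapping
`J[x] = {f ∈ X* : ⟨x, f⟩ = ‖x‖² = ‖f‖²}`. -/
def dualitySet {X : Type*} [NormedAddCommGroup X] [NormedSpace ℝ X] (x : X) :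
    Set (StrongDual ℝ X) :=
  {f | f x = ‖x‖ ^ 2 ∧ ‖f‖ ^ 2 = ‖x‖ ^ 2}

theorem dualitySet_nonempty {X : Type*} [NormedAddCommGroup X] [NormedSpace ℝ X] (x : X) :
    (dualitySet x).Nonempty := by
  by_cases hx : x = 0
  · exact ⟨0, by simp [dualitySet, hx]⟩
  · obtain ⟨g, hg, hgx⟩ := exists_dual_vector ℝ x (norm_ne_zero_iff.2 hx)
    refine ⟨‖x‖ • g, ?_, ?_⟩
    · simp only [smul_apply, hgx, smul_eq_mul]
      simp [sq]
    · simp [norm_smul, hg]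

/-- The duality map as a single-valued map; `dualitySet_eq_singleton` shows that it is the only
selection of `dualitySet` when the dual space is strictly convex. -/
def dualityMap {X : Type*} [NormedAddCommGroup X] [NormedSpace ℝ X] (x : X) : StrongDual ℝ X :=
  (dualitySet_nonempty x).choose

theorem dualitySet_eq_singleton {X : Type*} [NormedAddCommGroup X] [NormedSpace ℝ X]
    [StrictConvexSpace ℝ (StrongDual ℝ X)] (x : X) : dualitySet x = {dualityMap x} := by
  have huniq : ∀ f ∈ dualitySet x, ∀ g ∈ dualitySet x, f = g := by
    rintro f ⟨hf1, hf2⟩ g ⟨hg1, hg2⟩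
    have hf : ‖f‖ = ‖x‖ := by
      rwa [sq_eq_sq₀ (norm_nonneg _) (norm_nonneg _)] at hf2
    have hg : ‖g‖ = ‖x‖ := by
      rwa [sq_eq_sq₀ (norm_nonneg _) (norm_nonneg _)] at hg2
    by_cases hx : ‖x‖ = 0
    · rw [hx, norm_eq_zero] at hf hg
      rw [hf, hg]
    · have hx : 0 < ‖x‖ := lt_of_le_of_ne (norm_nonneg _) (Ne.symm hx)
      refine eq_of_norm_eq_of_norm_add_eq (hf.trans hg.symm) (le_antisymm (norm_add_le _ _) ?_)
      have h1 : (f + g) x ≤ ‖f + g‖ * ‖x‖ := (le_abs_self _).trans ((f + g).le_opNorm x)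
      rw [add_apply, hf1, hg1] at h1
      rw [hf, hg]
      nlinarith
  exact Set.eq_singleton_iff_unique_mem.2
    ⟨(dualitySet_nonempty x).choose_spec, fun f hf => huniq f hf _
      (dualitySet_nonempty x).choose_spec⟩

/-- The Banach space adjoint `B* : X* → U` of a bounded operator `B : U → X`, where the Hilbert
space `U` is identified with its dual. -/
def adjointToHilbert {X U : Type*} [NormedAddCommGroup X] [NormedSpace ℝ X]
    [NormedAddCommGroup U] [InnerProductSpace ℝ U] [CompleteSpace U]
    (B : U →L[ℝ] X) (f : StrongDual ℝ X) : U :=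
  (InnerProductSpace.toDual ℝ U).symm (f.comp B)

/-- The data of the linear regulator problem: the uniformly bounded `C₀`-semigroup generated by the
operator `A` of the control system `ᶜD^α x = A x + B u`, `x(0) = ζ`, the control operator `B`, the
order `α`, the horizon `T`, the weight `lam` of the control cost, the initial state and the
target. -/
structure LinearRegulator (X U : Type*) [NormedAddCommGroup X] [NormedSpace ℝ X]
    [NormedAddCommGroup U] [InnerProductSpace ℝ U] where
  /-- the semigroup generated by `A` -/
  S : C0Semigroup X
  bounded : ∃ M : ℝ, ∀ t, ‖S.op t‖ ≤ M
  /-- the control operator -/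
  B : U →L[ℝ] X
  /-- the order of the Caputo derivative -/
  α : ℝ
  half_lt_α : 1 / 2 < α
  α_lt_one : α < 1
  /-- the time horizon -/
  T : ℝ
  T_pos : 0 < T
  /-- the weight `λ` of the control cost -/
  lam : ℝ
  lam_pos : 0 < lam
  /-- the initial state -/
  ζ : X
  /-- the target state -/
  xT : X

namespace LinearRegulator

variable {X U : Type*} [NormedAddCommGroup X] [NormedSpace ℝ X]
  [NormedAddCommGroup U] [InnerProductSpace ℝ U]

/-- The solution family `T_α(t) x = ∫₀^∞ ϕ_α(ξ) S(t^α ξ) x dξ`, for `t ≥ 0`. -/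
def solOp (P : LinearRegulator X U) (t : ℝ) (x : X) : X :=
  ∫ ξ in Ioi (0 : ℝ), subordDensity P.α ξ • P.S.op (t ^ P.α * ξ).toNNReal x

theorem integrable_hatOp (P : LinearRegulator X U) (t : ℝ) (x : X) :
    IntegrableOn (fun ξ : ℝ => (ξ * subordDensity P.α ξ) • P.S.op (t ^ P.α * ξ).toNNReal x)
      (Ioi 0) := by
  obtain ⟨M, hM⟩ := P.bounded
  have h := integrableOn_mul_subordDensity (q := P.α) (by linarith [P.half_lt_α]) P.α_lt_one
  refine Integrable.smul_bdd h (M * ‖x‖) ?_ ?_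
  · refine Continuous.aestronglyMeasurable ?_
    exact (P.S.continuous_orbit x).comp (continuous_real_toNNReal.comp (by fun_prop))
  · exact Eventually.of_forall fun ξ => (P.S.op _).le_of_opNorm_le (hM _) x

/-- The bounded operator `T̂_α(t) x = α ∫₀^∞ ξ ϕ_α(ξ) S(t^α ξ) x dξ`, for `t ≥ 0`. -/
def hatOp (P : LinearRegulator X U) (t : ℝ) : X →L[ℝ] X :=
  LinearMap.mkContinuousOfExistsBound
    { toFun := fun x => P.α • ∫ ξ in Ioi (0 : ℝ),
        (ξ * subordDensity P.α ξ) • P.S.op (t ^ P.α * ξ).toNNReal x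
      map_add' := fun x y => by
        simp only [map_add, smul_add]
        rw [integral_add (P.integrable_hatOp t x) (P.integrable_hatOp t y), smul_add]
      map_smul' := fun c x => by
        simp only [map_smul, RingHom.id_apply]
        rw [smul_comm c P.α, ← integral_smul c]
        simp only [smul_comm c] }
    (by
      obtain ⟨M, hM⟩ := P.bounded
      have h := integrableOn_mul_subordDensity (q := P.α) (by linarith [P.half_lt_α]) P.α_lt_one
      refine ⟨|P.α| * ((∫ ξ in Ioi (0 : ℝ), ‖ξ * subordDensity P.α ξ‖) * M), fun x => ?_⟩
      simp only [LinearMap.coe_mk, AddHom.coe_mk]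
      rw [norm_smul, Real.norm_eq_abs, mul_assoc]
      gcongr
      rw [mul_assoc, ← integral_mul_const]
      refine norm_integral_le_of_norm_le (h.norm.mul_const _) (Eventually.of_forall fun ξ => ?_)
      rw [norm_smul]
      gcongr
      exact (P.S.op _).le_of_opNorm_le (hM _) x)

/-- The Banach space adjoint `T̂_α(t)* : X* → X*`. -/
def hatOpAdjoint (P : LinearRegulator X U) (t : ℝ) (f : StrongDual ℝ X) : StrongDual ℝ X :=
  f.comp (P.hatOp t)

/-- `x` is the mild solution on `[0, T]` of the linear control system with control `u`; the formula
determines `x` on `[0, T]` (and makes it continuous there when `u ∈ L²`). -/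
def IsMildSolution (P : LinearRegulator X U) (x : ℝ → X) (u : ℝ → U) : Prop :=
  ∀ t ∈ Icc 0 P.T, x t =
    P.solOp t P.ζ + ∫ s in (0 : ℝ)..t, (t - s) ^ (P.α - 1) • P.hatOp (t - s) (P.B (u s))

/-- The admissible class: `u ∈ L²([0, T]; U)` and `x` is the mild solution with control `u`. -/
def IsAdmissible (P : LinearRegulator X U) (x : ℝ → X) (u : ℝ → U) : Prop :=
  MemLp u 2 (volume.restrict (Icc 0 P.T)) ∧ P.IsMildSolution x u

/-- The cost functional `‖x(T) - x_T‖² + λ ∫₀ᵀ ‖u(t)‖² dt`. -/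
def cost (P : LinearRegulator X U) (x : ℝ → X) (u : ℝ → U) : ℝ :=
  ‖x P.T - P.xT‖ ^ 2 + P.lam * ∫ t in (0 : ℝ)..P.T, ‖u t‖ ^ 2

/-- `(x, u)` is an optimal pair: it minimizes the cost over the admissible class. -/
def IsOptimalPair (P : LinearRegulator X U) (x : ℝ → X) (u : ℝ → U) : Prop :=
  P.IsAdmissible x u ∧ ∀ y v, P.IsAdmissible y v → P.cost x u ≤ P.cost y v

variable [CompleteSpace U]

/-- The operator `Φ₀ᵀ : X* → X`,
`Φ₀ᵀ f = ∫₀ᵀ (T-t)^(2(α-1)) T̂_α(T-t) B B* T̂_α(T-t)* f dt`. -/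
def gramian (P : LinearRegulator X U) (f : StrongDual ℝ X) : X :=
  ∫ t in (0 : ℝ)..P.T, (P.T - t) ^ (2 * (P.α - 1)) •
    P.hatOp (P.T - t) (P.B (adjointToHilbert P.B (P.hatOpAdjoint (P.T - t) f)))

/-- The map `λ I + Φ₀ᵀ J : X → X`. -/
def shiftedGramian (P : LinearRegulator X U) (z : X) : X :=
  P.lam • z + P.gramian (dualityMap z)

/-- The resolvent `R(λ, Φ₀ᵀ) = (λ I + Φ₀ᵀ J)⁻¹`, the inverse map of `shiftedGramian`
(a genuine two-sided inverse as soon as `shiftedGramian` is bijective). -/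
def resolvent (P : LinearRegulator X U) : X → X :=
  Function.invFun P.shiftedGramian

/-- The feedback law
`(T-t)^(α-1) B* T̂_α(T-t)* J[R(λ, Φ₀ᵀ)(x_T - T_α(T) ζ)]`. -/
def feedback (P : LinearRegulator X U) (t : ℝ) : U :=
  (P.T - t) ^ (P.α - 1) • adjointToHilbert P.B
    (P.hatOpAdjoint (P.T - t) (dualityMap (P.resolvent (P.xT - P.solOp P.T P.ζ))))

end LinearRegulator

end FracRegulator

end

/-! Only the final state enters the cost, so inserting the mild solution turns the regulator problem
into minimizing `‖h - L u‖² + λ‖u‖²` over L²(0,T;U). Here h = x_T - T_α(T)ζ, and L u = ∫₀ᵀ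
(T-t)^(α-1) T̂_α(T-t) B u(t) dt satisfies L L* = Φ₀ᵀ on X*.

At a minimizer the Euler equation is λu = L* J[h - Lu]. With z = λ⁻¹(h - Lu), homogeneity of J gives
u = L* J[z], hence λz + L L* J[z] = h. Since L* acts as the pointwise adjoint of the kernel, u = L*
J[z] is the stated feedback law. Surjectivity of λI + Φ₀ᵀJ follows because a minimizer exists for
every h, and injectivity because J is monotone. The Euler equation needs no differentiability of the
norm: `two_mul_dualityMap_sub_le` and norm-to-weak* continuity of J (`continuous_dualityMap_apply`)
replace it.

The analytic input is that the kernel of L is square integrable in operator norm. The condition α >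
1/2 handles the singularity at T. The semigroup is only strongly continuous, but the substitution η
= t^α ξ moves t into the scalar density, and dilations are continuous in L¹(0,∞); so T̂_α is norm
continuous on (0,∞) (`continuousOn_hatOp`). This also gives continuity of the feedback. -/

noncomputable section

open MeasureTheory Set Filter Topology
open scoped NNReal ENNReal

namespace FracRegulator

/-! ### The duality map: subgradient inequality, homogeneity, weak* continuity -/

section DualityMap

variable {X : Type*} [NormedAddCommGroup X] [NormedSpace ℝ X]

theorem dualityMap_mem (x : X) : dualityMap x ∈ dualitySet x :=
  (dualitySet_nonempty x).choose_spec

theorem dualityMap_apply_self (x : X) : dualityMap x x = ‖x‖ ^ 2 :=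
  (dualityMap_mem x).1

theorem norm_dualityMap (x : X) : ‖dualityMap x‖ = ‖x‖ := by
  have h := (dualityMap_mem x).2
  rwa [sq_eq_sq₀ (norm_nonneg _) (norm_nonneg _)] at h

theorem dualityMap_apply_le (x y : X) : dualityMap x y ≤ ‖x‖ * ‖y‖ := by
  rw [← norm_dualityMap x]
  exact (le_abs_self _).trans ((dualityMap x).le_opNorm y)

/-- `2 J[y]` is a subgradient of `‖·‖²` at `y`. -/
theorem two_mul_dualityMap_sub_le (x y : X) :
    2 * dualityMap y (x - y) ≤ ‖x‖ ^ 2 - ‖y‖ ^ 2 := by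
  rw [map_sub, dualityMap_apply_self]
  nlinarith [dualityMap_apply_le y x, sq_nonneg (‖x‖ - ‖y‖)]

/-- The subgradient inequalities at `x` and at `y` add up, and the squared norms cancel. -/
theorem dualityMap_monotone (x y : X) : 0 ≤ (dualityMap x - dualityMap y) (x - y) := by
  have h1 := two_mul_dualityMap_sub_le x y
  have h2 := two_mul_dualityMap_sub_le y x
  rw [← neg_sub x y, map_neg] at h2
  rw [sub_apply]
  linarith

/-- A functional of norm at most `‖x‖` taking the value `‖x‖²` at `x` is `J[x]`. -/
theorem eq_dualityMap [StrictConvexSpace ℝ (StrongDual ℝ X)] {x : X} {f : StrongDual ℝ X}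
    (hf : f x = ‖x‖ ^ 2) (hf' : ‖f‖ ≤ ‖x‖) : f = dualityMap x := by
  have h : f ∈ dualitySet x := by
    refine ⟨hf, ?_⟩
    have h1 : ‖x‖ ^ 2 ≤ ‖f‖ * ‖x‖ := hf ▸ (le_abs_self _).trans (f.le_opNorm x)
    nlinarith [norm_nonneg f, norm_nonneg x]
  rwa [dualitySet_eq_singleton] at h

/-- Uniqueness of the duality functional yields this for scalars of either sign. It later moves the
factor λ⁻¹ inside J. -/
theorem dualityMap_smul [StrictConvexSpace ℝ (StrongDual ℝ X)] (c : ℝ) (x : X) :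
    dualityMap (c • x) = c • dualityMap x := by
  refine (eq_dualityMap ?_ ?_).symm
  · rw [smul_apply, map_smul, dualityMap_apply_self, norm_smul, Real.norm_eq_abs, mul_pow, sq_abs,
      smul_eq_mul, smul_eq_mul]
    ring
  · rw [norm_smul, norm_smul, norm_dualityMap]

/-- The duality map into a strictly convex dual is norm-to-weak* continuous. -/
theorem continuous_dualityMap_apply [StrictConvexSpace ℝ (StrongDual ℝ X)] (y : X) :
    Continuous fun x : X => dualityMap x y := by
  suffices h : Continuous fun x : X => StrongDual.toWeakDual (dualityMap x) from
    (WeakDual.eval_continuous y).comp h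
  refine continuous_iff_continuousAt.2 fun x => ?_
  refine (tendsto_iff_ultrafilter _ _ _).2 fun l hl => ?_
  -- Along an ultrafilter finer than `𝓝 x` the functionals J[z] eventually lie in a fixed ball,
  -- which is weak* compact by Banach–Alaoglu. They therefore converge, and it remains to identify
  -- the limit `f` with J[x].
  have hb : ∀ᶠ z in (l : Filter X), StrongDual.toWeakDual (dualityMap z) ∈
      WeakDual.toStrongDual ⁻¹' Metric.closedBall (0 : StrongDual ℝ X) (‖x‖ + 1) := by
    have h : ∀ᶠ z in 𝓝 x, ‖z‖ < ‖x‖ + 1 :=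
      continuous_norm.continuousAt.eventually_lt_const (by linarith)
    filter_upwards [hl h] with z hz
    have hz : ‖z‖ < ‖x‖ + 1 := hz
    simpa [norm_dualityMap] using hz.le
  obtain ⟨f, -, hf⟩ := (WeakDual.isCompact_closedBall (𝕜 := ℝ) (0 : StrongDual ℝ X)
    (‖x‖ + 1)).ultrafilter_le_nhds (l.map fun z => StrongDual.toWeakDual (dualityMap z))
    (le_principal_iff.2 hb)
  have hlim : ∀ v : X, Tendsto (fun z => dualityMap z v) l (𝓝 (f v)) := fun v =>
    ((WeakDual.eval_continuous v).tendsto f).comp hf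
  have hnorm : Tendsto (fun z : X => ‖z‖) l (𝓝 ‖x‖) := continuous_norm.continuousAt.mono_left hl
  have hsub : Tendsto (fun z : X => ‖z - x‖) l (𝓝 0) := by
    have h : Continuous fun z : X => ‖z - x‖ := by fun_prop
    simpa using h.continuousAt.mono_left hl
  have key : WeakDual.toStrongDual f = dualityMap x := by
    refine eq_dualityMap ?_ ?_
    · refine tendsto_nhds_unique (hlim x) ?_
      -- J[z](x) = ‖z‖² - J[z](z - x), and the last term is at most ‖z‖‖z - x‖ in absolute value.
      have h1 : Tendsto (fun z : X => dualityMap z (z - x)) l (𝓝 0) := by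
        refine squeeze_zero_norm (fun z => ?_) (by simpa using hnorm.mul hsub)
        rw [← norm_dualityMap z]
        exact (dualityMap z).le_opNorm _
      have h2 := (hnorm.pow 2).sub h1
      rw [sub_zero] at h2
      refine h2.congr fun z => ?_
      rw [map_sub, dualityMap_apply_self]
      ring
    · refine ContinuousLinearMap.opNorm_le_bound _ (norm_nonneg _) fun v => ?_
      refine le_of_tendsto_of_tendsto (hlim v).norm (hnorm.mul_const ‖v‖)
        (Eventually.of_forall fun z => ?_)
      simp only
      rw [← norm_dualityMap z]
      exact (dualityMap z).le_opNorm _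
  have : f = StrongDual.toWeakDual (dualityMap x) := by rw [← key]; rfl
  rw [this] at hf
  exact hf

end DualityMap

/-! ### Tikhonov minimization in a Hilbert space and its Euler equation -/

section Tikhonov

variable {X H : Type*} [NormedAddCommGroup X] [NormedSpace ℝ X]
  [NormedAddCommGroup H] [InnerProductSpace ℝ H]

/-- The Tikhonov functional `‖h - L u‖² + c ‖u‖²`. -/
def tikhonov (L : H →L[ℝ] X) (c : ℝ) (h : X) (u : H) : ℝ :=
  ‖h - L u‖ ^ 2 + c * ‖u‖ ^ 2

/-- Strong convexity comes entirely from the Hilbert penalty, through the parallelogram law. The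
residual term contributes only convexity of the squared norm. -/
theorem tikhonov_midpoint_le (L : H →L[ℝ] X) (c : ℝ) (h : X) (u v : H) :
    tikhonov L c h ((2⁻¹ : ℝ) • (u + v)) + c / 4 * ‖u - v‖ ^ 2
      ≤ (tikhonov L c h u + tikhonov L c h v) / 2 := by
  have h1 : ‖h - L ((2⁻¹ : ℝ) • (u + v))‖ ≤ (‖h - L u‖ + ‖h - L v‖) / 2 := by
    have e : h - L ((2⁻¹ : ℝ) • (u + v)) = (2⁻¹ : ℝ) • ((h - L u) + (h - L v)) := by
      rw [map_smul, map_add]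
      module
    rw [e, norm_smul]
    have := norm_add_le (h - L u) (h - L v)
    norm_num
    linarith
  have h2 := parallelogram_law_with_norm ℝ u v
  have h3 : ‖(2⁻¹ : ℝ) • (u + v)‖ = ‖u + v‖ / 2 := by
    rw [norm_smul]; norm_num; ring
  have h4 : ‖h - L ((2⁻¹ : ℝ) • (u + v))‖ ^ 2 ≤ (‖h - L u‖ ^ 2 + ‖h - L v‖ ^ 2) / 2 := by
    nlinarith [norm_nonneg (h - L ((2⁻¹ : ℝ) • (u + v))), sq_nonneg (‖h - L u‖ - ‖h - L v‖)]
  have h5 : c * ‖(2⁻¹ : ℝ) • (u + v)‖ ^ 2 + c / 4 * ‖u - v‖ ^ 2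
      = (c * ‖u‖ ^ 2 + c * ‖v‖ ^ 2) / 2 := by
    rw [h3]; linear_combination c / 4 * h2
  unfold tikhonov
  linarith

/-- By strong convexity a minimizing sequence is Cauchy in norm, so no weak compactness is needed.
-/
theorem exists_isMinOn_tikhonov [CompleteSpace H] (L : H →L[ℝ] X) {c : ℝ} (hc : 0 < c) (h : X) :
    ∃ u : H, ∀ v, tikhonov L c h u ≤ tikhonov L c h v := by
  have hpos : ∀ v, 0 ≤ tikhonov L c h v := fun v => by unfold tikhonov; positivity
  have hbdd : BddBelow (range (tikhonov L c h)) := ⟨0, by rintro _ ⟨v, rfl⟩; exact hpos v⟩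
  set d := ⨅ v, tikhonov L c h v with hd
  have hle : ∀ v, d ≤ tikhonov L c h v := fun v => ciInf_le hbdd v
  have hex : ∀ n : ℕ, ∃ u, tikhonov L c h u < d + 1 / ((n : ℝ) + 1) := fun n =>
    exists_lt_of_ciInf_lt (lt_add_of_pos_right _ Nat.one_div_pos_of_nat)
  choose w hw using hex
  have hcauchy : CauchySeq w := by
    refine cauchySeq_of_le_tendsto_0 (fun N : ℕ => √(4 / c * (1 / ((N : ℝ) + 1)))) ?_ ?_
    · intro n m N hn hm
      rw [dist_eq_norm]
      refine Real.le_sqrt_of_sq_le ?_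
      have h1 := tikhonov_midpoint_le L c h (w n) (w m)
      have h2 := hle ((2⁻¹ : ℝ) • (w n + w m))
      have h3 : 1 / ((n : ℝ) + 1) ≤ 1 / ((N : ℝ) + 1) := Nat.one_div_le_one_div hn
      have h4 : 1 / ((m : ℝ) + 1) ≤ 1 / ((N : ℝ) + 1) := Nat.one_div_le_one_div hm
      -- The midpoint value is at least the infimum `d`, while both endpoint values are below `d +
      -- 1/(N+1)`.
      have h5 : c / 4 * ‖w n - w m‖ ^ 2 ≤ 1 / ((N : ℝ) + 1) := by linarith [hw n, hw m]
      calc ‖w n - w m‖ ^ 2 = 4 / c * (c / 4 * ‖w n - w m‖ ^ 2) := by field_simp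
        _ ≤ _ := by gcongr
    · have h1 := (tendsto_one_div_add_atTop_nhds_zero_nat (𝕜 := ℝ)).const_mul (4 / c)
      simpa using h1.sqrt
  obtain ⟨u, hu⟩ := cauchySeq_tendsto_of_complete hcauchy
  refine ⟨u, fun v => le_trans ?_ (hle v)⟩
  have hcont : Continuous (tikhonov L c h) := by unfold tikhonov; fun_prop
  have h1 := (hcont.tendsto u).comp hu
  have h2 := (tendsto_one_div_add_atTop_nhds_zero_nat (𝕜 := ℝ)).const_add d
  rw [add_zero] at h2
  exact le_of_tendsto_of_tendsto h1 h2 (Eventually.of_forall fun n => (hw n).le)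

/-- The Euler equation of the Tikhonov functional. -/
theorem dualityMap_apply_eq_of_isMinOn_tikhonov [StrictConvexSpace ℝ (StrongDual ℝ X)]
    {L : H →L[ℝ] X} {c : ℝ} {h : X} {u : H}
    (hu : ∀ v, tikhonov L c h u ≤ tikhonov L c h v) (v : H) :
    dualityMap (h - L u) (L v) = c * inner ℝ u v := by
  -- One inequality for all `v` suffices, because both sides are linear in `v` and `v` can be
  -- replaced by `-v`.
  have hle : ∀ v : H, dualityMap (h - L u) (L v) ≤ c * inner ℝ u v := by
    intro v
    have hcont : Continuous fun t : ℝ => dualityMap (h - L u - t • L v) (L v) :=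
      (continuous_dualityMap_apply (L v)).comp (by fun_prop)
    have h1 : Tendsto (fun t : ℝ => dualityMap (h - L u - t • L v) (L v)) (𝓝[>] 0)
        (𝓝 (dualityMap (h - L u) (L v))) := by
      simpa using (hcont.tendsto 0).mono_left nhdsWithin_le_nhds
    have h2 : Tendsto (fun t : ℝ => c * inner ℝ u v + t * (c / 2 * ‖v‖ ^ 2)) (𝓝[>] 0)
        (𝓝 (c * inner ℝ u v)) := by
      have : Continuous fun t : ℝ => c * inner ℝ u v + t * (c / 2 * ‖v‖ ^ 2) := by fun_prop
      simpa using (this.tendsto 0).mono_left nhdsWithin_le_nhds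
    refine le_of_tendsto_of_tendsto h1 h2 ?_
    filter_upwards [self_mem_nhdsWithin] with t ht
    have ht : 0 < t := ht
    have h3 := hu (u + t • v)
    have e : h - L (u + t • v) = h - L u - t • L v := by
      rw [map_add, map_smul]; abel
    unfold tikhonov at h3
    rw [e, norm_add_sq_real, norm_smul, inner_smul_right, Real.norm_of_nonneg ht.le] at h3
    -- The subgradient is taken at the perturbed residual, so that it bounds J from above.
    -- Minimality, division by `t` and `t → 0⁺` then finish, with continuity of J returning to the
    -- unperturbed residual.
    have h4 := two_mul_dualityMap_sub_le (h - L u) (h - L u - t • L v)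
    rw [sub_sub_cancel, map_smul, smul_eq_mul] at h4
    have h5 : t * dualityMap (h - L u - t • L v) (L v)
        ≤ t * (c * inner ℝ u v + t * (c / 2 * ‖v‖ ^ 2)) := by nlinarith
    exact le_of_mul_le_mul_left h5 ht
  refine le_antisymm (hle v) ?_
  have := hle (-v)
  rw [map_neg, map_neg, inner_neg_right] at this
  linarith

variable [CompleteSpace H]

theorem inner_adjointToHilbert (L : H →L[ℝ] X) (f : StrongDual ℝ X) (v : H) :
    inner ℝ (adjointToHilbert L f) v = f (L v) := by
  simp [adjointToHilbert]

theorem eq_adjointToHilbert {L : H →L[ℝ] X} {f : StrongDual ℝ X} {u : H}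
    (hu : ∀ v, inner ℝ u v = f (L v)) : u = adjointToHilbert L f :=
  ext_inner_right ℝ fun v => by rw [hu, inner_adjointToHilbert]

/-- `λ I + L L* J` is injective. -/
theorem injective_shifted (L : H →L[ℝ] X) {c : ℝ} (hc : 0 < c) :
    Function.Injective fun z : X => c • z + L (adjointToHilbert L (dualityMap z)) := by
  intro x y hxy
  simp only at hxy
  set a := adjointToHilbert L (dualityMap x) with ha
  set b := adjointToHilbert L (dualityMap y) with hb
  have h1 : c • (x - y) + L (a - b) = 0 := by
    rw [map_sub, ← sub_eq_zero.2 hxy]; module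
  have h2 : (dualityMap x - dualityMap y) (L (a - b)) = ‖a - b‖ ^ 2 := by
    rw [← real_inner_self_eq_norm_sq, inner_sub_left (x := a) (y := b), ha, hb,
      inner_adjointToHilbert, inner_adjointToHilbert, sub_apply]
  -- Applied to `h1`, J[x] - J[y] gives two nonnegative terms with sum zero. Hence `a = b`, and `h1`
  -- reduces to `c • (x - y) = 0`; strict monotonicity of J is not required.
  have h3 := congrArg (dualityMap x - dualityMap y) h1
  rw [map_add, map_smul, h2, map_zero, smul_eq_mul] at h3
  have h4 := mul_nonneg hc.le (dualityMap_monotone x y)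
  have h5 : ‖a - b‖ ^ 2 = 0 := le_antisymm (by linarith) (sq_nonneg _)
  have h6 : a - b = 0 := by simpa using h5
  rw [h6, map_zero, add_zero, smul_eq_zero] at h1
  exact sub_eq_zero.1 (h1.resolve_left hc.ne')

/-- A minimizer `u` of the Tikhonov functional is `L* J[z]`, where `z` solves
`(λ I + L L* J) z = h`. -/
theorem isMinOn_tikhonov_eq [StrictConvexSpace ℝ (StrongDual ℝ X)] {L : H →L[ℝ] X} {c : ℝ}
    (hc : 0 < c) {h : X} {u : H}
    (hu : ∀ v, tikhonov L c h u ≤ tikhonov L c h v) :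
    u = adjointToHilbert L (dualityMap (c⁻¹ • (h - L u))) ∧
      c • (c⁻¹ • (h - L u)) + L (adjointToHilbert L (dualityMap (c⁻¹ • (h - L u)))) = h := by
  have h1 : u = adjointToHilbert L (dualityMap (c⁻¹ • (h - L u))) := by
    refine eq_adjointToHilbert fun v => ?_
    rw [dualityMap_smul, smul_apply, dualityMap_apply_eq_of_isMinOn_tikhonov hu, smul_eq_mul,
      inv_mul_cancel_left₀ hc.ne']
  refine ⟨h1, ?_⟩
  rw [← h1, smul_inv_smul₀ hc.ne', sub_add_cancel]

/-- Surjectivity is variational: a preimage of `h` is the scaled residual of a Tikhonov minimizer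
with data `h`. -/
theorem bijective_shifted [StrictConvexSpace ℝ (StrongDual ℝ X)] (L : H →L[ℝ] X) {c : ℝ}
    (hc : 0 < c) :
    Function.Bijective fun z : X => c • z + L (adjointToHilbert L (dualityMap z)) := by
  refine ⟨injective_shifted L hc, fun h => ?_⟩
  obtain ⟨u, hu⟩ := exists_isMinOn_tikhonov L hc h
  exact ⟨_, (isMinOn_tikhonov_eq hc hu).2⟩

end Tikhonov

/-! ### Continuity and a monotone majorant of the density from its ray integral -/

theorem measurable_rayKernel (q δ β ξ : ℝ) : Measurable (rayKernel q δ β ξ) := by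
  unfold rayKernel
  fun_prop

theorem norm_rayKernel_le {q δ β ξ t : ℝ} (hβ : 0 < Real.cos β) (hξ : 0 < ξ) (ht : 0 < t) :
    ‖rayKernel q δ β ξ t‖ ≤ Real.exp (-Real.cos δ * t) := by
  rw [norm_rayKernel]
  refine mul_le_of_le_one_left (Real.exp_pos _).le (Real.exp_le_one_iff.2 ?_)
  have : 0 < Real.cos β * t ^ q * ξ := by positivity
  linarith

theorem integrable_rayKernel_slice {q δ β ξ : ℝ} (hδ : 0 < Real.cos δ) (hβ : 0 < Real.cos β)
    (hξ : 0 < ξ) : IntegrableOn (rayKernel q δ β ξ) (Ioi 0) := by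
  refine Integrable.mono' (integrableOn_exp_mul_Ioi (neg_lt_zero.2 hδ) 0)
    (measurable_rayKernel q δ β ξ).aestronglyMeasurable ?_
  filter_upwards [ae_restrict_mem measurableSet_Ioi] with t ht
  exact norm_rayKernel_le hβ hξ ht

/-- For fixed `t` the norm of the kernel decays exponentially in `ξ`, because `cos β > 0`. -/
theorem antitoneOn_integral_norm_rayKernel {q δ β : ℝ} (hδ : 0 < Real.cos δ)
    (hβ : 0 < Real.cos β) :
    AntitoneOn (fun ξ => ∫ t in Ioi (0 : ℝ), ‖rayKernel q δ β ξ t‖) (Ioi 0) := by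
  intro ξ hξ η hη hle
  refine setIntegral_mono_on (integrable_rayKernel_slice hδ hβ hη).norm
    (integrable_rayKernel_slice hδ hβ hξ).norm measurableSet_Ioi fun t ht => ?_
  have ht : 0 < t := ht
  rw [norm_rayKernel, norm_rayKernel]
  have : 0 < Real.cos β * t ^ q := by positivity
  gcongr ?_ * _
  apply Real.exp_le_exp.2
  nlinarith

theorem continuousOn_integral_rayKernel {q δ β : ℝ} (hδ : 0 < Real.cos δ)
    (hβ : 0 < Real.cos β) :
    ContinuousOn (fun ξ => ∫ t in Ioi (0 : ℝ), rayKernel q δ β ξ t) (Ioi 0) := by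
  refine continuousOn_of_dominated (bound := fun t => Real.exp (-Real.cos δ * t))
    (fun ξ _ => (measurable_rayKernel q δ β ξ).aestronglyMeasurable) (fun ξ hξ => ?_)
    (integrableOn_exp_mul_Ioi (neg_lt_zero.2 hδ) 0) (Eventually.of_forall fun t => ?_)
  · filter_upwards [ae_restrict_mem measurableSet_Ioi] with t ht
    exact norm_rayKernel_le hβ hξ ht
  · refine Continuous.continuousOn ?_
    unfold rayKernel
    fun_prop

/-- At δ = π/2 the angle q(π - δ) equals qπ/2 < π/2. Lowering δ by an amount proportional to 1 - q
keeps that angle below π/2 and makes cos δ positive. -/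
theorem exists_ray_angle {q : ℝ} (hq0 : 0 < q) (hq : q < 1) :
    ∃ δ : ℝ, 0 < Real.cos δ ∧ 0 < Real.cos (q * (Real.pi - δ)) ∧
      -Real.pi < -δ ∧ -δ ≤ Real.pi := by
  have hpi := Real.pi_pos
  refine ⟨Real.pi / 2 - Real.pi * (1 - q) / 4,
    Real.cos_pos_of_mem_Ioo ⟨by nlinarith, by nlinarith⟩, ?_, by nlinarith, by nlinarith⟩
  have h1 : q * (Real.pi - (Real.pi / 2 - Real.pi * (1 - q) / 4))
      = Real.pi / 2 - Real.pi / 4 * ((1 - q) * (2 - q)) := by ring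
  have h2 : 0 < (1 - q) * (2 - q) := by nlinarith
  have h3 : (1 - q) * (2 - q) < 2 := by nlinarith
  exact Real.cos_pos_of_mem_Ioo ⟨by rw [h1]; nlinarith, by rw [h1]; nlinarith⟩

/-- `ξ ϕ_q(ξ)` is continuous on `(0, ∞)`. -/
theorem continuousOn_mul_subordDensity {q : ℝ} (hq0 : 0 < q) (hq : q < 1) :
    ContinuousOn (fun ξ => ξ * subordDensity q ξ) (Ioi 0) := by
  obtain ⟨δ, hc1, hc2, h1, h2⟩ := exists_ray_angle hq0 hq
  refine ContinuousOn.congr ?_ fun ξ hξ => mul_subordDensity hq0 hq hc1 h1 h2 hξ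
  exact continuousOn_const.mul (Complex.continuous_im.comp_continuousOn
    (continuousOn_const.mul (continuousOn_integral_rayKernel hc1 hc2)))

/-- `ξ ϕ_q(ξ)` has a nonincreasing integrable majorant on `(0, ∞)`. -/
theorem exists_antitoneOn_majorant_mul_subordDensity {q : ℝ} (hq0 : 0 < q) (hq : q < 1) :
    ∃ b : ℝ → ℝ, AntitoneOn b (Ioi 0) ∧ IntegrableOn b (Ioi 0) ∧
      ∀ ξ ∈ Ioi (0 : ℝ), ‖ξ * subordDensity q ξ‖ ≤ b ξ := by
  obtain ⟨δ, hc1, hc2, h1, h2⟩ := exists_ray_angle hq0 hq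
  have hpi := Real.pi_pos
  refine ⟨fun ξ => 1 / (Real.pi * q) *
    ∫ t in Ioi (0 : ℝ), ‖rayKernel q δ (q * (Real.pi - δ)) ξ t‖, ?_, ?_, fun ξ hξ => ?_⟩
  · intro ξ hξ η hη hle
    have := antitoneOn_integral_norm_rayKernel (q := q) hc1 hc2 hξ hη hle
    exact mul_le_mul_of_nonneg_left this (by positivity)
  · exact (integrable_rayKernel hq hc1 hc2).norm.integral_prod_left.const_mul _
  · rw [mul_subordDensity hq0 hq hc1 h1 h2 hξ, norm_mul, norm_neg,
      Real.norm_of_nonneg (by positivity : 0 ≤ 1 / (Real.pi * q))]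
    refine mul_le_mul_of_nonneg_left ?_ (by positivity)
    refine (Complex.abs_im_le_norm _).trans ?_
    rw [norm_mul, ← neg_mul, ← Complex.ofReal_neg, Complex.norm_exp_ofReal_mul_I, one_mul]
    exact norm_integral_le_integral_norm _

/-! ### Continuity of dilations in L¹(0,∞) -/

section Dilation

variable {m b : ℝ → ℝ}

theorem continuousOn_dilation (hm : ContinuousOn m (Ioi 0)) {s : ℝ} (hs : 0 < s) :
    ContinuousOn (fun η => m (s * η)) (Ioi 0) :=
  hm.comp (by fun_prop) fun η hη => mul_pos hs hη

/-- Continuity of dilations in `L¹(0, ∞)`. -/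
theorem tendsto_integral_norm_dilation_sub (hm : ContinuousOn m (Ioi 0))
    (hb : AntitoneOn b (Ioi 0)) (hbi : IntegrableOn b (Ioi 0))
    (hmb : ∀ ξ ∈ Ioi (0 : ℝ), ‖m ξ‖ ≤ b ξ) {s₀ : ℝ} (hs₀ : 0 < s₀) :
    Tendsto (fun s => ∫ η in Ioi (0 : ℝ), ‖m (s * η) - m (s₀ * η)‖) (𝓝 s₀) (𝓝 0) := by
  -- For `s > s₀/2` the nonincreasing majorant bounds every dilate by `b (s₀ / 2 * η)`, a single
  -- integrable function suitable for dominated convergence.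
  have hhalf : ∀ᶠ s in 𝓝 s₀, s₀ / 2 < s := lt_mem_nhds (by linarith)
  have hle : ∀ s, s₀ / 2 < s → ∀ η ∈ Ioi (0 : ℝ), ‖m (s * η)‖ ≤ b (s₀ / 2 * η) := by
    intro s hs η hη
    have hη : 0 < η := hη
    have h1 : 0 < s₀ / 2 * η := by positivity
    have h2 : s₀ / 2 * η ≤ s * η := by gcongr
    exact (hmb _ (h1.trans_le h2)).trans (hb h1 (h1.trans_le h2) h2)
  have hint : IntegrableOn (fun η => b (s₀ / 2 * η)) (Ioi 0) := by
    rw [integrableOn_Ioi_comp_mul_left_iff _ _ (by positivity), mul_zero]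
    exact hbi
  have key := tendsto_integral_filter_of_dominated_convergence
    (μ := volume.restrict (Ioi (0 : ℝ))) (l := 𝓝 s₀)
    (F := fun s η => ‖m (s * η) - m (s₀ * η)‖) (f := fun _ => 0)
    (fun η => b (s₀ / 2 * η) + b (s₀ / 2 * η)) ?_ ?_ (hint.add hint) ?_
  · simpa using key
  · filter_upwards [hhalf] with s hs
    exact (((continuousOn_dilation hm (by linarith)).sub
      (continuousOn_dilation hm hs₀)).norm).aestronglyMeasurable measurableSet_Ioi
  · filter_upwards [hhalf] with s hs
    filter_upwards [ae_restrict_mem measurableSet_Ioi] with η hη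
    rw [norm_norm]
    exact (norm_sub_le _ _).trans (add_le_add (hle s hs η hη) (hle s₀ (by linarith) η hη))
  · filter_upwards [ae_restrict_mem measurableSet_Ioi] with η hη
    have hη : 0 < η := hη
    have h1 : ContinuousAt m (s₀ * η) := hm.continuousAt (Ioi_mem_nhds (by positivity))
    have h2 : Tendsto (fun s => m (s * η)) (𝓝 s₀) (𝓝 (m (s₀ * η))) :=
      h1.tendsto.comp ((continuous_id.mul continuous_const).tendsto s₀)
    simpa using (h2.sub_const (m (s₀ * η))).norm

end Dilation

/-! ### Uniform bound and operator-norm continuity of T̂_α -/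

namespace LinearRegulator

variable {X U : Type*} [NormedAddCommGroup X] [NormedSpace ℝ X]
  [NormedAddCommGroup U] [InnerProductSpace ℝ U]

theorem α_pos (P : LinearRegulator X U) : 0 < P.α := by linarith [P.half_lt_α]

theorem hatOp_apply (P : LinearRegulator X U) (t : ℝ) (x : X) :
    P.hatOp t x = P.α • ∫ ξ in Ioi (0 : ℝ),
      (ξ * subordDensity P.α ξ) • P.S.op (t ^ P.α * ξ).toNNReal x := rfl

/-- The semigroup bound is independent of time, so C = α M ∫ |ξ ϕ_α(ξ)| dξ works for all `t`. -/
theorem exists_norm_hatOp_le (P : LinearRegulator X U) : ∃ C : ℝ, 0 ≤ C ∧ ∀ t, ‖P.hatOp t‖ ≤ C := by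
  obtain ⟨M, hM⟩ := P.bounded
  have hM0 : 0 ≤ M := (norm_nonneg _).trans (hM 0)
  have h := integrableOn_mul_subordDensity P.α_pos P.α_lt_one
  have hI : 0 ≤ ∫ ξ in Ioi (0 : ℝ), ‖ξ * subordDensity P.α ξ‖ :=
    integral_nonneg fun _ => norm_nonneg _
  have hα := P.α_pos
  refine ⟨P.α * ((∫ ξ in Ioi (0 : ℝ), ‖ξ * subordDensity P.α ξ‖) * M), by positivity, fun t => ?_⟩
  refine ContinuousLinearMap.opNorm_le_bound _ (by positivity) fun x => ?_
  rw [hatOp_apply, norm_smul, Real.norm_of_nonneg hα.le, mul_assoc]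
  gcongr
  rw [mul_assoc, ← integral_mul_const]
  refine norm_integral_le_of_norm_le (h.norm.mul_const _) (Eventually.of_forall fun ξ => ?_)
  rw [norm_smul]
  gcongr
  exact (P.S.op _).le_of_opNorm_le (hM _) x

/-- Substituting `η = t^α ξ` moves the dependence on `t` from the semigroup to the density. -/
theorem rpow_smul_hatOp_apply (P : LinearRegulator X U) {t : ℝ} (ht : 0 < t) (x : X) :
    t ^ P.α • P.hatOp t x = P.α • ∫ η in Ioi (0 : ℝ),
      (((t ^ P.α)⁻¹ * η) * subordDensity P.α ((t ^ P.α)⁻¹ * η)) • P.S.op η.toNNReal x := by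
  have hs : 0 < t ^ P.α := by positivity
  have h := integral_comp_mul_left_Ioi
    (fun ξ => (ξ * subordDensity P.α ξ) • P.S.op (t ^ P.α * ξ).toNNReal x) 0 (inv_pos.2 hs)
  simp only [mul_inv_cancel_left₀ hs.ne', inv_inv, mul_zero] at h
  rw [h, hatOp_apply, smul_comm]

theorem integrableOn_dilation_smul_op (P : LinearRegulator X U) {s : ℝ} (hs : 0 < s) (x : X) :
    IntegrableOn (fun η => ((s * η) * subordDensity P.α (s * η)) • P.S.op η.toNNReal x)
      (Ioi 0) := by
  obtain ⟨M, hM⟩ := P.bounded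
  have h : IntegrableOn (fun η => (s * η) * subordDensity P.α (s * η)) (Ioi 0) := by
    rw [integrableOn_Ioi_comp_mul_left_iff (fun ξ => ξ * subordDensity P.α ξ) _ hs, mul_zero]
    exact integrableOn_mul_subordDensity P.α_pos P.α_lt_one
  refine Integrable.smul_bdd h (M * ‖x‖) ?_ ?_
  · exact ((P.S.continuous_orbit x).comp continuous_real_toNNReal).aestronglyMeasurable
  · exact Eventually.of_forall fun ξ => (P.S.op _).le_of_opNorm_le (hM _) x

/-- `T̂_α` is continuous on `(0, ∞)` in the operator norm. -/
theorem continuousOn_hatOp (P : LinearRegulator X U) : ContinuousOn P.hatOp (Ioi 0) := by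
  obtain ⟨M, hM⟩ := P.bounded
  have hM0 : 0 ≤ M := (norm_nonneg _).trans (hM 0)
  have hα := P.α_pos
  obtain ⟨b, hb, hbi, hmb⟩ := exists_antitoneOn_majorant_mul_subordDensity hα P.α_lt_one
  have hm := continuousOn_mul_subordDensity hα P.α_lt_one
  have hmi := integrableOn_mul_subordDensity hα P.α_lt_one
  intro t₀ ht₀
  have ht₀ : 0 < t₀ := ht₀
  refine ContinuousAt.continuousWithinAt ?_
  set m : ℝ → ℝ := fun ξ => ξ * subordDensity P.α ξ with hmdef
  have hs₀ : 0 < (t₀ ^ P.α)⁻¹ := by positivity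
  have hrpow : ContinuousAt (fun t : ℝ => t ^ P.α) t₀ :=
    (Real.continuous_rpow_const hα.le).continuousAt
  have hinv : Tendsto (fun t : ℝ => (t ^ P.α)⁻¹) (𝓝 t₀) (𝓝 (t₀ ^ P.α)⁻¹) :=
    hrpow.inv₀ (by positivity)
  have hlim := ((tendsto_integral_norm_dilation_sub hm hb hbi hmb hs₀).comp hinv).const_mul
    (P.α * M)
  rw [mul_zero] at hlim
  -- After the substitution both integrals carry the same S(η)x, so the difference is controlled,
  -- uniformly for ‖x‖ ≤ 1, by the L¹ distance of two dilates of the density.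
  have hle : ∀ᶠ t in 𝓝 t₀, ‖t ^ P.α • P.hatOp t - t₀ ^ P.α • P.hatOp t₀‖ ≤
      P.α * M * ∫ η in Ioi (0 : ℝ), ‖m ((t ^ P.α)⁻¹ * η) - m ((t₀ ^ P.α)⁻¹ * η)‖ := by
    filter_upwards [lt_mem_nhds ht₀] with t ht
    have hs : 0 < (t ^ P.α)⁻¹ := by positivity
    have hI : 0 ≤ ∫ η in Ioi (0 : ℝ), ‖m ((t ^ P.α)⁻¹ * η) - m ((t₀ ^ P.α)⁻¹ * η)‖ :=
      integral_nonneg fun _ => norm_nonneg _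
    refine ContinuousLinearMap.opNorm_le_bound _ (by positivity) fun x => ?_
    rw [sub_apply, smul_apply, smul_apply, P.rpow_smul_hatOp_apply ht,
      P.rpow_smul_hatOp_apply ht₀, ← smul_sub, ← integral_sub
      (P.integrableOn_dilation_smul_op hs x) (P.integrableOn_dilation_smul_op hs₀ x),
      norm_smul, Real.norm_of_nonneg hα.le, mul_assoc, mul_assoc]
    gcongr
    rw [mul_left_comm, ← integral_mul_const]
    have hdil : ∀ {s : ℝ}, 0 < s → IntegrableOn (fun η => m (s * η)) (Ioi 0) := fun {s} hs => by
      rw [integrableOn_Ioi_comp_mul_left_iff m _ hs, mul_zero]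
      exact hmi
    refine norm_integral_le_of_norm_le (((hdil hs).sub (hdil hs₀)).norm.mul_const _)
      (Eventually.of_forall fun η => ?_)
    rw [← sub_smul, norm_smul]
    refine mul_le_mul_of_nonneg_left ?_ (norm_nonneg _)
    exact (P.S.op _).le_of_opNorm_le (hM _) x
  have h1 : Tendsto (fun t => t ^ P.α • P.hatOp t) (𝓝 t₀) (𝓝 (t₀ ^ P.α • P.hatOp t₀)) := by
    rw [tendsto_iff_norm_sub_tendsto_zero]
    exact squeeze_zero' (Eventually.of_forall fun _ => norm_nonneg _) hle hlim
  have h2 := hinv.smul h1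
  rw [inv_smul_smul₀ (by positivity)] at h2
  refine h2.congr' ?_
  filter_upwards [lt_mem_nhds ht₀] with t ht
  rw [inv_smul_smul₀ (by positivity)]

end LinearRegulator

/-! ### Operators on L² given by square-integrable kernels, and their adjoints -/

section KernelOp

variable {Ω X U : Type*} [MeasurableSpace Ω] {μ : Measure Ω}
  [NormedAddCommGroup X] [NormedSpace ℝ X]
  [NormedAddCommGroup U] [InnerProductSpace ℝ U]
  {k : Ω → U →L[ℝ] X}

/-- The operator `v ↦ ∫ k(s) v(s) dμ(s)` on `L²(μ; U)` defined by a square integrable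
operator-valued function `k`. -/
def kernelOp [CompleteSpace X] (hk : MemLp k 2 μ) : Lp U 2 μ →L[ℝ] X :=
  (ContinuousLinearMap.id ℝ (U →L[ℝ] X)).lpPairing μ 2 2 hk.toLp

theorem kernelOp_apply [CompleteSpace X] (hk : MemLp k 2 μ) {v : Lp U 2 μ} {w : Ω → U} (hvw : v =ᵐ[μ] w) :
    kernelOp hk v = ∫ s, k s (w s) ∂μ := by
  rw [kernelOp, ContinuousLinearMap.lpPairing_eq_integral]
  refine integral_congr_ae ?_
  filter_upwards [hk.coeFn_toLp, hvw] with s h1 h2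
  rw [h1, h2]
  rfl

theorem norm_toLp_two_sq {w : Ω → U} (hw : MemLp w 2 μ) :
    ‖hw.toLp w‖ ^ 2 = ∫ s, ‖w s‖ ^ 2 ∂μ := by
  rw [← real_inner_self_eq_norm_sq, L2.inner_def]
  refine integral_congr_ae ?_
  filter_upwards [hw.coeFn_toLp] with s hs
  rw [hs, real_inner_self_eq_norm_sq]

variable [CompleteSpace U]

theorem norm_adjointToHilbert_le (L : U →L[ℝ] X) (f : StrongDual ℝ X) :
    ‖adjointToHilbert L f‖ ≤ ‖f‖ * ‖L‖ := by
  rw [adjointToHilbert, LinearIsometryEquiv.norm_map]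
  exact f.opNorm_comp_le L

theorem continuous_adjointToHilbert_left (f : StrongDual ℝ X) :
    Continuous fun L : U →L[ℝ] X => adjointToHilbert L f := by
  unfold adjointToHilbert
  exact (InnerProductSpace.toDual ℝ U).symm.continuous.comp
    (ContinuousLinearMap.compL ℝ U X ℝ f).continuous

theorem memLp_adjointToHilbert (hk : MemLp k 2 μ) (f : StrongDual ℝ X) :
    MemLp (fun s => adjointToHilbert (k s) f) 2 μ :=
  MemLp.of_le_mul hk ((continuous_adjointToHilbert_left f).comp_aestronglyMeasurable hk.1)
    (Eventually.of_forall fun s => norm_adjointToHilbert_le (k s) f)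

/-- The adjoint of `kernelOp` is the pointwise adjoint of the kernel. -/
theorem adjointToHilbert_kernelOp [CompleteSpace X] (hk : MemLp k 2 μ) (f : StrongDual ℝ X) :
    (adjointToHilbert (kernelOp hk) f : Lp U 2 μ) =ᵐ[μ] fun s => adjointToHilbert (k s) f := by
  have h : (memLp_adjointToHilbert hk f).toLp _ = adjointToHilbert (kernelOp hk) f := by
    -- The adjoint is identified by testing against `v`: `f` passes under the Bochner integral, and
    -- the pointwise adjoint identity applies inside.
    refine eq_adjointToHilbert fun v => ?_
    have hint : Integrable (fun s => k s (v s)) μ := memLp_one_iff_integrable.1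
      ((ContinuousLinearMap.id ℝ (U →L[ℝ] X)).memLp_of_bilin 1 hk (Lp.memLp v))
    rw [kernelOp_apply hk (EventuallyEq.refl _ v), ← f.integral_comp_comm hint, L2.inner_def]
    refine integral_congr_ae ?_
    filter_upwards [(memLp_adjointToHilbert hk f).coeFn_toLp] with s hs
    rw [hs, inner_adjointToHilbert]
  rw [← h]
  exact (memLp_adjointToHilbert hk f).coeFn_toLp

end KernelOp

/-! ### The regulator problem as a Tikhonov problem -/

namespace LinearRegulator

variable {X U : Type*} [NormedAddCommGroup X] [NormedSpace ℝ X]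
  [NormedAddCommGroup U] [InnerProductSpace ℝ U]

/-- The input kernel `(T-t)^(α-1) T̂_α(T-t) B`. -/
def inputKernel (P : LinearRegulator X U) (t : ℝ) : U →L[ℝ] X :=
  (P.T - t) ^ (P.α - 1) • (P.hatOp (P.T - t)).comp P.B

theorem inputKernel_apply (P : LinearRegulator X U) (t : ℝ) (v : U) :
    P.inputKernel t v = (P.T - t) ^ (P.α - 1) • P.hatOp (P.T - t) (P.B v) := rfl

theorem continuousOn_inputKernel (P : LinearRegulator X U) :
    ContinuousOn P.inputKernel (Iio P.T) := by
  have hsub : ContinuousOn (fun t => P.T - t) (Iio P.T) := by fun_prop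
  have hmaps : MapsTo (fun t => P.T - t) (Iio P.T) (Ioi 0) := fun t ht =>
    mem_Ioi.2 (sub_pos.2 ht)
  have h1 : ContinuousOn (fun t => P.hatOp (P.T - t)) (Iio P.T) :=
    P.continuousOn_hatOp.comp hsub hmaps
  have h2 : ContinuousOn (fun t => (P.T - t) ^ (P.α - 1)) (Iio P.T) :=
    hsub.rpow_const fun t ht => Or.inl (sub_pos.2 ht).ne'
  exact h2.smul (((ContinuousLinearMap.compL ℝ U X X).flip P.B).continuous.comp_continuousOn h1)

theorem rpow_sub_one_sq (P : LinearRegulator X U) {t : ℝ} (ht : t ≤ P.T) :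
    ((P.T - t) ^ (P.α - 1)) ^ 2 = (P.T - t) ^ (2 * (P.α - 1)) := by
  rw [mul_comm, Real.rpow_mul (sub_nonneg.2 ht), Real.rpow_two]

/-- T̂_α is bounded, so only the scalar singularity matters; α > 1/2 gives 2(α - 1) > -1, which
makes its square integrable. -/
theorem memLp_inputKernel (P : LinearRegulator X U) :
    MemLp P.inputKernel 2 (volume.restrict (Ioc 0 P.T)) := by
  obtain ⟨C, hC0, hC⟩ := P.exists_norm_hatOp_le
  have hpow : MemLp (fun t => (P.T - t) ^ (P.α - 1)) 2 (volume.restrict (Ioc 0 P.T)) := by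
    rw [memLp_two_iff_integrable_sq (by
      apply Measurable.aestronglyMeasurable
      fun_prop)]
    have h1 : IntervalIntegrable (fun x : ℝ => x ^ (2 * (P.α - 1))) volume 0 P.T :=
      intervalIntegral.intervalIntegrable_rpow' (by linarith [P.half_lt_α])
    have h2 := (h1.comp_sub_left P.T).symm
    rw [sub_zero, sub_self, intervalIntegrable_iff_integrableOn_Ioc_of_le P.T_pos.le] at h2
    refine h2.congr ?_
    filter_upwards [ae_restrict_mem measurableSet_Ioc] with t ht
    rw [P.rpow_sub_one_sq ht.2]
  have hmeas : AEStronglyMeasurable P.inputKernel (volume.restrict (Ioc 0 P.T)) := by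
    -- Norm continuity of the kernel is available only for `t < T`; the endpoint is a null set.
    rw [← Measure.restrict_congr_set (Ioo_ae_eq_Ioc (a := (0 : ℝ)) (b := P.T))]
    exact (P.continuousOn_inputKernel.mono Ioo_subset_Iio_self).aestronglyMeasurable
      measurableSet_Ioo
  refine hpow.of_le_mul (c := C * ‖P.B‖) hmeas (Eventually.of_forall fun t => ?_)
  rw [inputKernel, norm_smul, mul_comm]
  gcongr
  exact (ContinuousLinearMap.opNorm_comp_le _ _).trans (by gcongr; exact hC _)

/-- The input-to-final-state operator `u ↦ ∫₀ᵀ (T-t)^(α-1) T̂_α(T-t) B u(t) dt`. -/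
def inputOp [CompleteSpace X] (P : LinearRegulator X U) : Lp U 2 (volume.restrict (Ioc 0 P.T)) →L[ℝ] X :=
  kernelOp P.memLp_inputKernel

theorem cost_eq_tikhonov [CompleteSpace X] (P : LinearRegulator X U) {x : ℝ → X} {u : ℝ → U}
    (hx : P.IsMildSolution x u) (hu : MemLp u 2 (volume.restrict (Ioc 0 P.T))) :
    P.cost x u = tikhonov P.inputOp P.lam (P.xT - P.solOp P.T P.ζ) (hu.toLp u) := by
  rw [cost, tikhonov, norm_toLp_two_sq, intervalIntegral.integral_of_le P.T_pos.le,
    hx P.T ⟨P.T_pos.le, le_rfl⟩, inputOp, kernelOp_apply _ hu.coeFn_toLp,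
    intervalIntegral.integral_of_le P.T_pos.le, ← norm_neg]
  simp only [inputKernel_apply]
  congr 3
  abel

/-- Every L² class is an admissible control, since the mild solution formula defines its state;
optimality over pairs thus becomes minimality over the whole L² space. -/
theorem isMinOn_tikhonov_of_isOptimalPair [CompleteSpace X] (P : LinearRegulator X U) {x : ℝ → X} {u : ℝ → U}
    (h : P.IsOptimalPair x u) (hu : MemLp u 2 (volume.restrict (Ioc 0 P.T)))
    (v : Lp U 2 (volume.restrict (Ioc 0 P.T))) :
    tikhonov P.inputOp P.lam (P.xT - P.solOp P.T P.ζ) (hu.toLp u) ≤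
      tikhonov P.inputOp P.lam (P.xT - P.solOp P.T P.ζ) v := by
  have hv : MemLp v 2 (volume.restrict (Icc 0 P.T)) := by
    rw [← Measure.restrict_congr_set (Ioc_ae_eq_Icc (a := (0 : ℝ)) (b := P.T))]
    exact Lp.memLp v
  set y : ℝ → X := fun t =>
    P.solOp t P.ζ + ∫ s in (0 : ℝ)..t, (t - s) ^ (P.α - 1) • P.hatOp (t - s) (P.B (v s))
  have hy : P.IsMildSolution y v := fun t _ => rfl
  have h1 := h.2 y v ⟨hv, hy⟩
  rwa [P.cost_eq_tikhonov h.1.2 hu, P.cost_eq_tikhonov hy (Lp.memLp v), Lp.toLp_coeFn] at h1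

variable [CompleteSpace U]

theorem adjointToHilbert_inputKernel (P : LinearRegulator X U) (t : ℝ) (f : StrongDual ℝ X) :
    adjointToHilbert (P.inputKernel t) f = (P.T - t) ^ (P.α - 1) •
      adjointToHilbert P.B (P.hatOpAdjoint (P.T - t) f) := by
  refine (eq_adjointToHilbert fun v => ?_).symm
  rw [inner_smul_left, inner_adjointToHilbert, inputKernel_apply, map_smul]
  rfl

/-- One factor (T-t)^(α-1) comes from the operator and one from its adjoint; together they form the
weight (T-t)^(2(α-1)). -/
theorem gramian_eq [CompleteSpace X] (P : LinearRegulator X U) (f : StrongDual ℝ X) :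
    P.gramian f = P.inputOp (adjointToHilbert P.inputOp f) := by
  rw [gramian, intervalIntegral.integral_of_le P.T_pos.le, inputOp,
    kernelOp_apply _ (adjointToHilbert_kernelOp P.memLp_inputKernel f)]
  refine setIntegral_congr_fun measurableSet_Ioc fun t ht => ?_
  rw [adjointToHilbert_inputKernel, inputKernel_apply, map_smul, map_smul, smul_smul, ← sq,
    P.rpow_sub_one_sq ht.2]

theorem shiftedGramian_eq [CompleteSpace X] (P : LinearRegulator X U) :
    P.shiftedGramian =
      fun z => P.lam • z + P.inputOp (adjointToHilbert P.inputOp (dualityMap z)) := by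
  funext z
  rw [shiftedGramian, gramian_eq]

theorem bijective_shiftedGramian [CompleteSpace X] [StrictConvexSpace ℝ (StrongDual ℝ X)]
    (P : LinearRegulator X U) : Function.Bijective P.shiftedGramian := by
  rw [shiftedGramian_eq]
  exact bijective_shifted P.inputOp P.lam_pos

theorem feedback_eq (P : LinearRegulator X U) (t : ℝ) :
    P.feedback t = adjointToHilbert (P.inputKernel t)
      (dualityMap (P.resolvent (P.xT - P.solOp P.T P.ζ))) := by
  rw [adjointToHilbert_inputKernel, feedback]

theorem continuousOn_feedback (P : LinearRegulator X U) :
    ContinuousOn P.feedback (Ico 0 P.T) := by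
  refine ContinuousOn.congr ?_ fun t _ => P.feedback_eq t
  exact (continuous_adjointToHilbert_left _).comp_continuousOn
    (P.continuousOn_inputKernel.mono Ico_subset_Iio_self)

theorem ae_eq_feedback_of_isOptimalPair [CompleteSpace X] [StrictConvexSpace ℝ (StrongDual ℝ X)]
    (P : LinearRegulator X U) {x : ℝ → X} {u : ℝ → U} (h : P.IsOptimalPair x u) :
    ∀ᵐ t ∂(volume.restrict (Ico 0 P.T)), u t = P.feedback t := by
  rw [Measure.restrict_congr_set (Ico_ae_eq_Ioc (a := (0 : ℝ)) (b := P.T))]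
  have hu : MemLp u 2 (volume.restrict (Ioc 0 P.T)) := by
    rw [Measure.restrict_congr_set (Ioc_ae_eq_Icc (a := (0 : ℝ)) (b := P.T))]
    exact h.1.1
  obtain ⟨h1, h2⟩ := isMinOn_tikhonov_eq P.lam_pos (P.isMinOn_tikhonov_of_isOptimalPair h hu)
  set z := P.lam⁻¹ • (P.xT - P.solOp P.T P.ζ - P.inputOp (hu.toLp u))
  -- `h2` says that the scaled residual `z` solves the resolvent equation, and injectivity makes it
  -- the value selected by `invFun`.
  have hz : P.resolvent (P.xT - P.solOp P.T P.ζ) = z := by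
    have h3 : P.shiftedGramian z = P.xT - P.solOp P.T P.ζ := by rw [shiftedGramian_eq]; exact h2
    rw [resolvent, ← h3, Function.leftInverse_invFun P.bijective_shiftedGramian.1]
  have h4 := adjointToHilbert_kernelOp P.memLp_inputKernel (dualityMap z)
  change (adjointToHilbert P.inputOp (dualityMap z) : Lp U 2 _) =ᵐ[_] _ at h4
  rw [← h1] at h4
  filter_upwards [hu.coeFn_toLp, h4] with t h5 h6
  rw [← h5, h6, feedback_eq, hz]

end LinearRegulator

end FracRegulator

end

theorem lemma3p2 {X U : Type*}
    [NormedAddCommGroup X] [NormedSpace ℝ X] [CompleteSpace X]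
    [TopologicalSpace.SeparableSpace X] [StrictConvexSpace ℝ (StrongDual ℝ X)]
    (hreflexive : Function.Surjective (NormedSpace.inclusionInDoubleDual ℝ X))
    [NormedAddCommGroup U] [InnerProductSpace ℝ U] [CompleteSpace U]
    [TopologicalSpace.SeparableSpace U]
    (P : FracRegulator.LinearRegulator X U) (x : ℝ → X) (u : ℝ → U)
    (hopt : P.IsOptimalPair x u) :
    Function.Bijective P.shiftedGramian ∧
      ContinuousOn P.feedback (Set.Ico 0 P.T) ∧
      ∀ᵐ t ∂(MeasureTheory.volume.restrict (Set.Ico 0 P.T)), u t = P.feedback t :=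
  ⟨P.bijective_shiftedGramian, P.continuousOn_feedback, P.ae_eq_feedback_of_isOptimalPair hopt⟩
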